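/- Let $\mathsf K$ be a field, $A$ a finite-dimensional $\mathsf K$-algebra and $\mathscr P$ a finite poset. A $\mathscr P$-multiplicative system $\mathcal T$ over $A$ is a family of subspaces $\mathcal T_{i,j}\subseteq A$ ($i\le j$) with $\mathcal T_{i,j}\mathcal T_{j,l}\subseteq \mathcal T_{i,l}$ such that each $\mathcal T_{i}=\mathcal T_{i,i}$ has a unit $1_i$ with $1_i r=r=r1_j$ for $r\in\mathcal T_{i,j}$; its incidence algebra is $\Lambda(\mathcal T)=\bigoplus_{i\le j}e_{i,j}\mathcal T_{i,j}$ with matrix multiplication, and $e_i=e_{i,i}1_i$. A system $\mathcal R$ on a poset with greatest point $\mathbf m$ is admissible if every $\mathcal R_i$ is a division ring and for $0\ne x\in\mathcal R_{i,j}$, $j<\mathbf m$, there are $l\neq j$ and $y\in\mathcal R_{j,l}$ with $xy\ne0$. Let $(\mathscr P,A,\mathcal T)$ be extendable: every $\mathcal T_i$ is a (unital) subalgebra of $A$, and, for the extension $\mathcal T^{\mathbf m}$ of $\mathcal T$ to $\mathscr P^{\mathbf m}=\mathscr P\cup\{\mathbf m\}$ (a greatest point $\mathbf m$ is added, with $\mathcal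 T_{i,\mathbf m}=A$), there are idempotents $\varepsilon_i\in\mathcal T_{i}$ ($i\in\mathscr P^{\mathbf m}$) such that $A$ is semisimple with $\varepsilon_{\mathbf m}A$ as its only simple right module up to isomorphism, the system $(\varepsilon_i\mathcal T_{i,j}\varepsilon_j)$ on $\mathscr P^{\mathbf m}$ is admissible, and its incidence algebra is Morita equivalent to $\Lambda(\mathcal T^{\mathbf m})$. Fix such idempotents. Add further a least point $0$ with $\mathcal T_{0,i}=A$ for all $i$, put $\varepsilon_0=\varepsilon_{\mathbf m}$, and let $\Lambda$ be the incidence algebra of the system $(\varepsilon_i\mathcal T_{i,j}\varepsilon_j)$ on $\{0\}\cup\mathscr P\cup\{\mathbf m\}$. All modules are right $\Lambda$-modules. Let $\mathcal M$ be the category of morphisms $\phi:P\to(e_0\Lambda)^{(\nu)}$, where $\nu$ is a set, $P$ is projective, $Pe_0=0$ and $\mathrm{Im}\,\phi\subseteq\mathrm{rad}\,(e_0\Lambda)^{(\nu)}$; its morphisms are commutative squares. Let $\mathcal M_0\subseteq\mathcal M$ be the full subcategory of the objects that do not have $0\to e_0\Lambda$ as a direct summand. Let $\mathcal V^{+}$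 be the full subcategory of $\mathrm{Mod}\text{-}\Lambda$ of modules $N$ whose top $N/\mathrm{rad}\,N$ is injective, and $\mathcal V\subseteq\mathcal V^{+}$ the full subcategory of those that do not have $e_0\Lambda$ as a direct summand. Let $\overline{\mathcal M}$ and $\overline{\mathcal M_0}$ be the quotients of $\mathcal M$ and $\mathcal M_0$ by the morphisms that factor through objects of the form $P\to0$ (with $P$ projective, $Pe_0=0$). Then the cokernel functor sends $\mathcal M$ into $\mathcal V^{+}$ and $\mathcal M_0$ into $\mathcal V$, and the functors it induces, $$\mathrm{Cok}:\overline{\mathcal M}\to\mathcal V^{+}\qquad\text{and}\qquad \mathrm{Cok}:\overline{\mathcal M_0}\to\mathcal V,$$ are equivalences of categories. -/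

import Mathlib

open CategoryTheory

universe u

noncomputable section

namespace EquippedPoset

/-- A `P`-multiplicative system over the `K`-algebra `A`: subspaces `R_{i,j} ⊆ A` for `i ≤ j` with
`R_{i,j} R_{j,l} ⊆ R_{i,l}`, such that every `R_{i,i}` has a unit `1_i`, and `1_i r = r = r 1_j`
for `r ∈ R_{i,j}`. The value of `space i j` is irrelevant when `i ≤ j` fails. -/
structure MultSystem (K A P : Type u) [Field K] [Ring A] [Algebra K A] [PartialOrder P] where
  space : P → P → Submodule K A
  one : P → A
  mul_mem : ∀ {i j l : P}, i ≤ j → j ≤ l → ∀ {r s : A},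
    r ∈ space i j → s ∈ space j l → r * s ∈ space i l
  one_mem : ∀ i, one i ∈ space i i
  one_mul : ∀ {i j : P}, i ≤ j → ∀ {r : A}, r ∈ space i j → one i * r = r
  mul_one : ∀ {i j : P}, i ≤ j → ∀ {r : A}, r ∈ space i j → r * one j = r

namespace MultSystem

variable {K A P : Type u} [Field K] [Ring A] [Algebra K A] [PartialOrder P]

/-! ### The incidence algebra -/

section Incidence

variable [Fintype P] [DecidableEq P] (R : MultSystem K A P)

/-- The matrices `(a_{i,j})` over `A` with `a_{i,j} ∈ R_{i,j}` for `i ≤ j` and `a_{i,j} = 0`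
otherwise; closed under matrix multiplication. -/
def incidenceSubalgebra : NonUnitalSubalgebra K (Matrix P P A) where
  carrier := {a | (∀ i j, i ≤ j → a i j ∈ R.space i j) ∧ ∀ i j, ¬ i ≤ j → a i j = 0}
  add_mem' := by
    rintro a b ⟨ha, ha'⟩ ⟨hb, hb'⟩
    refine ⟨fun i j h => add_mem (ha i j h) (hb i j h), fun i j h => ?_⟩
    simp [ha' i j h, hb' i j h]
  zero_mem' := ⟨fun i j _ => zero_mem _, fun i j _ => rfl⟩
  mul_mem' := by
    rintro a b ⟨ha, ha'⟩ ⟨hb, hb'⟩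
    refine ⟨fun i l h => ?_, fun i l h => ?_⟩
    · rw [Matrix.mul_apply]
      refine sum_mem fun j _ => ?_
      by_cases h1 : i ≤ j
      · by_cases h2 : j ≤ l
        · exact R.mul_mem h1 h2 (ha i j h1) (hb j l h2)
        · simp [hb' j l h2]
      · simp [ha' i j h1]
    · rw [Matrix.mul_apply]
      refine Finset.sum_eq_zero fun j _ => ?_
      by_cases h1 : i ≤ j
      · have h2 : ¬ j ≤ l := fun h2 => h (h1.trans h2)
        simp [hb' j l h2]
      · simp [ha' i j h1]
  smul_mem' := by
    rintro c a ⟨ha, ha'⟩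
    refine ⟨fun i j h => Submodule.smul_mem _ c (ha i j h), fun i j h => ?_⟩
    simp [ha' i j h]

/-- The incidence algebra `Λ(R) = ⨁_{i ≤ j} e_{i,j} R_{i,j}`. -/
def Lam : Type u := R.incidenceSubalgebra

instance : NonUnitalRing R.Lam := inferInstanceAs (NonUnitalRing R.incidenceSubalgebra)

instance : Module K R.Lam := inferInstanceAs (Module K R.incidenceSubalgebra)

/-- The unit of `Λ(R)` is the diagonal matrix with entries `1_i`. -/
instance : One R.Lam where
  one := ⟨Matrix.diagonal R.one, by
    refine ⟨fun i j _ => ?_, fun i j h => ?_⟩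
    · by_cases hij : i = j
      · subst hij; simpa using R.one_mem i
      · simp [Matrix.diagonal_apply_ne _ hij]
    · exact Matrix.diagonal_apply_ne _ (fun hij => h hij.le)⟩

instance : Ring R.Lam :=
  { (inferInstance : NonUnitalRing R.Lam), (inferInstance : One R.Lam) with
    one_mul := by
      rintro ⟨a, ha, ha'⟩
      refine Subtype.ext (Matrix.ext fun i j => ?_)
      change (Matrix.diagonal R.one * a) i j = a i j
      rw [Matrix.diagonal_mul]
      by_cases h : i ≤ j
      · exact R.one_mul h (ha i j h)
      · simp [ha' i j h]
    mul_one := by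
      rintro ⟨a, ha, ha'⟩
      refine Subtype.ext (Matrix.ext fun i j => ?_)
      change (a * Matrix.diagonal R.one) i j = a i j
      rw [Matrix.mul_diagonal]
      by_cases h : i ≤ j
      · exact R.mul_one h (ha i j h)
      · simp [ha' i j h] }

instance : Algebra K R.Lam :=
  Algebra.ofModule
    (fun c a b => Subtype.ext (Matrix.smul_mul c a.1 b.1))
    (fun c a b => Subtype.ext (Matrix.mul_smul a.1 c b.1))

/-- The idempotent `e_i = e_{i,i} 1_i` of `Λ(R)`. -/
def e (i : P) : R.Lam :=
  ⟨Matrix.single i i (R.one i), by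
    refine ⟨fun k l _ => ?_, fun k l h => ?_⟩
    · by_cases h : i = k ∧ i = l
      · obtain ⟨rfl, rfl⟩ := h
        simpa using R.one_mem i
      · rw [Matrix.single_apply, if_neg h]; exact zero_mem _
    · rw [Matrix.single_apply, if_neg]
      rintro ⟨rfl, rfl⟩
      exact h le_rfl⟩

end Incidence

/-! ### Operations on multiplicative systems -/

/-- The diagonal spaces `R_{i,i}` are (unital) subalgebras of `A`. -/
def IsUnital (T : MultSystem K A P) : Prop := ∀ i, (1 : A) ∈ T.space i i

lemma IsUnital.one_mul_self {T : MultSystem K A P} (h : T.IsUnital) (i : P) : T.one i = 1 := by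
  have := T.one_mul le_rfl (h i)
  simpa using this

/-- Adjoin a greatest point `m`, with `T_{i,m} = A` for all `i ≤ m`. -/
def addTop (T : MultSystem K A P) (hT : T.IsUnital) : MultSystem K A (WithTop P) where
  space i j := WithTop.recTopCoe ⊤ (fun j' => WithTop.recTopCoe ⊥ (fun i' => T.space i' j') i) j
  one _ := 1
  mul_mem := by
    intro i j l hij hjl r s hr hs
    induction l using WithTop.recTopCoe with
    | top => exact Submodule.mem_top
    | coe l =>
      induction j using WithTop.recTopCoe with
      | top => simp at hjl
      | coe j =>
        induction i using WithTop.recTopCoe with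
        | top => simp at hij
        | coe i => exact T.mul_mem (WithTop.coe_le_coe.1 hij) (WithTop.coe_le_coe.1 hjl) hr hs
  one_mem i := by
    induction i using WithTop.recTopCoe with
    | top => exact Submodule.mem_top
    | coe i => exact hT i
  one_mul _ _ _ := _root_.one_mul _
  mul_one _ _ _ := _root_.mul_one _

lemma addTop_isUnital (T : MultSystem K A P) (hT : T.IsUnital) : (T.addTop hT).IsUnital :=
  (T.addTop hT).one_mem

/-- Adjoin a least point `0`, with `T_{0,i} = A` for all `i ≥ 0`. -/
def addBot (T : MultSystem K A P) (hT : T.IsUnital) : MultSystem K A (WithBot P) where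
  space i j := WithBot.recBotCoe ⊤ (fun i' => WithBot.recBotCoe ⊥ (fun j' => T.space i' j') j) i
  one _ := 1
  mul_mem := by
    intro i j l hij hjl r s hr hs
    induction i using WithBot.recBotCoe with
    | bot => exact Submodule.mem_top
    | coe i =>
      induction j using WithBot.recBotCoe with
      | bot => simp at hij
      | coe j =>
        induction l using WithBot.recBotCoe with
        | bot => simp at hjl
        | coe l => exact T.mul_mem (WithBot.coe_le_coe.1 hij) (WithBot.coe_le_coe.1 hjl) hr hs
  one_mem i := by
    induction i using WithBot.recBotCoe with
    | bot => exact Submodule.mem_top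
    | coe i => exact hT i
  one_mul _ _ _ := _root_.one_mul _
  mul_one _ _ _ := _root_.mul_one _

/-- The system `(ε_i T_{i,j} ε_j)` attached to idempotents `ε_i ∈ T_{i,i}`; its units are
the `ε_i`. -/
def corner (T : MultSystem K A P) (ε : P → A) (hε : ∀ i, IsIdempotentElem (ε i))
    (hmem : ∀ i, ε i ∈ T.space i i) : MultSystem K A P where
  space i j := (T.space i j).map (LinearMap.mulLeft K (ε i) ∘ₗ LinearMap.mulRight K (ε j))
  one := ε
  mul_mem := by
    rintro i j l hij hjl _ _ ⟨r, hr, rfl⟩ ⟨s, hs, rfl⟩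
    refine ⟨r * ε j * s, T.mul_mem hij hjl (T.mul_mem hij le_rfl hr (hmem j)) hs, ?_⟩
    have h := (hε j).eq
    simp only [LinearMap.comp_apply, LinearMap.mulLeft_apply, LinearMap.mulRight_apply]
    calc ε i * (r * ε j * s * ε l) = ε i * (r * (ε j * ε j) * s * ε l) := by rw [h]
      _ = _ := by simp only [mul_assoc]
  one_mem i := ⟨ε i, hmem i, by simp [(hε i).eq]⟩
  one_mul := by
    rintro i j _ _ ⟨r, _, rfl⟩
    simp only [LinearMap.comp_apply, LinearMap.mulLeft_apply, LinearMap.mulRight_apply]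
    rw [← mul_assoc, (hε i).eq]
  mul_one := by
    rintro i j _ _ ⟨r, _, rfl⟩
    simp only [LinearMap.comp_apply, LinearMap.mulLeft_apply, LinearMap.mulRight_apply]
    rw [mul_assoc, mul_assoc, (hε j).eq]

/-- Admissible systems over a poset with greatest point `m = ⊤`. -/
structure IsAdmissible [OrderTop P] (R : MultSystem K A P) : Prop where
  /-- `R_{i,i}` is a division ring (with unit `1_i`). -/
  one_ne_zero : ∀ i, R.one i ≠ 0
  exists_inv : ∀ i, ∀ x ∈ R.space i i, x ≠ 0 →
    ∃ y ∈ R.space i i, x * y = R.one i ∧ y * x = R.one i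
  /-- A nonzero `x ∈ R_{i,j}` with `j < m` is not annihilated by all the `R_{j,l}`, `l ≠ j`. -/
  exists_mul_ne_zero : ∀ i j, i ≤ j → j < ⊤ → ∀ x ∈ R.space i j, x ≠ 0 →
    ∃ l, j ≤ l ∧ l ≠ j ∧ ∃ y ∈ R.space j l, x * y ≠ 0

end MultSystem

/-- The right ideal `xB`, as a right `B`-module (right modules are modules over `Bᵐᵒᵖ`). -/
abbrev rightIdeal {B : Type u} [Ring B] (x : B) : Submodule Bᵐᵒᵖ B := Submodule.span Bᵐᵒᵖ {x}

/-- The data exhibiting the algebraically equipped poset `(P, A, T)` as extendable. -/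
structure Extendable {K A P : Type u} [Field K] [Ring A] [Algebra K A] [PartialOrder P]
    [Fintype P] [DecidableEq P] (T : MultSystem K A P) where
  unital : T.IsUnital
  /-- The idempotents `ε_i`, `i ∈ P ∪ {m}`. -/
  ε : WithTop P → A
  idem : ∀ i, IsIdempotentElem (ε i)
  mem : ∀ i, ε i ∈ (T.addTop unital).space i i
  /-- `A` is semisimple and `ε_m A` is its only simple right module up to isomorphism. -/
  semisimple : IsSemisimpleRing A
  simple : IsSimpleModule Aᵐᵒᵖ (rightIdeal (ε ⊤))
  unique : ∀ (S : Type u) [AddCommGroup S] [Module Aᵐᵒᵖ S] [IsSimpleModule Aᵐᵒᵖ S],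
    Nonempty (S ≃ₗ[Aᵐᵒᵖ] rightIdeal (ε ⊤))
  /-- The system `R_{i,j} = ε_i T_{i,j} ε_j` on `P ∪ {m}` is admissible. -/
  admissible : ((T.addTop unital).corner ε idem mem).IsAdmissible
  /-- Its incidence algebra is Morita equivalent to that of `T` extended to `P ∪ {m}`. -/
  morita : IsMoritaEquivalent K ((T.addTop unital).corner ε idem mem).Lamᵐᵒᵖ
    (T.addTop unital).Lamᵐᵒᵖ

namespace Extendable

variable {K A P : Type u} [Field K] [Ring A] [Algebra K A] [PartialOrder P]
  [Fintype P] [DecidableEq P] {T : MultSystem K A P} (X : Extendable T)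

/-- The idempotents `ε_i` for `i ∈ {0} ∪ P ∪ {m}`, with `ε_0 = ε_m`. -/
def ε₀ : WithBot (WithTop P) → A := WithBot.recBotCoe (X.ε ⊤) X.ε

/-- The system `ε_i T_{i,j} ε_j` on `{0} ∪ P ∪ {m}`, where `T_{0,i} = A` for all `i`. -/
def fullSystem : MultSystem K A (WithBot (WithTop P)) :=
  ((T.addTop X.unital).addBot (T.addTop_isUnital X.unital)).corner X.ε₀
    (fun i => by
      induction i using WithBot.recBotCoe with
      | bot => exact X.idem ⊤
      | coe i => exact X.idem i)
    (fun i => by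
      induction i using WithBot.recBotCoe with
      | bot => exact Submodule.mem_top
      | coe i => exact X.mem i)

/-- The `1`-Gorenstein incidence algebra `Λ` of the extended poset `{0} ∪ P ∪ {m}`. -/
abbrev Λ : Type u := X.fullSystem.Lam

/-- The idempotent `e_0` of `Λ`. -/
def e0 : X.Λ := X.fullSystem.e ⊥

/-- The category of right `Λ`-modules. -/
abbrev ModΛ : Type (u + 1) := ModuleCat.{u} X.Λᵐᵒᵖ

/-- The right `Λ`-module `e_0 Λ`. -/
abbrev e0Λ : X.ModΛ := ModuleCat.of X.Λᵐᵒᵖ (rightIdeal X.e0)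

/-- Right `Λ`-modules `N` whose top `N / rad N` is injective. -/
def InjTop : ObjectProperty X.ModΛ := fun N =>
  Module.Injective X.Λᵐᵒᵖ (N ⧸ Module.jacobson X.Λᵐᵒᵖ N)

/-- The objects of `𝒱`: right `Λ`-modules with injective top that do not have `e_0 Λ` as a direct
summand (equivalently, as a retract). -/
def IsV : ObjectProperty X.ModΛ := fun N => X.InjTop N ∧ IsEmpty (Retract X.e0Λ N)

/-- `N e_0 = 0`. -/
def KillsE0 (N : X.ModΛ) : Prop := ∀ x : N, MulOpposite.op X.e0 • x = 0

/-- The objects of `ℳ`: morphisms `φ : Q → (e_0 Λ)^{(ν)}`, `ν` any set, with `Q` projective,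
`Q e_0 = 0` and image contained in the radical of the target. -/
def IsM : ObjectProperty (Arrow X.ModΛ) := fun φ =>
  Module.Projective X.Λᵐᵒᵖ φ.left ∧ X.KillsE0 φ.left ∧
  (∃ ν : Type u, Nonempty (φ.right ≅ ModuleCat.of X.Λᵐᵒᵖ (ν →₀ X.e0Λ))) ∧
  LinearMap.range φ.hom.hom ≤ Module.jacobson X.Λᵐᵒᵖ φ.right

/-- The objects of `ℳ` that do not have `0 → e_0 Λ` as a direct summand (equivalently, as a
retract). -/
def IsM₀ : ObjectProperty (Arrow X.ModΛ) := fun φ =>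
  X.IsM φ ∧
  IsEmpty (Retract (Arrow.mk (0 : ModuleCat.of X.Λᵐᵒᵖ PUnit.{u + 1} ⟶ X.e0Λ)) φ)

variable {X}

/-- Two morphisms of a full subcategory of the category of morphisms of `Mod-Λ` are identified when
their difference factors through an object `Q → 0` of it. -/
def homRel (W : ObjectProperty (Arrow X.ModΛ)) : HomRel W.FullSubcategory := fun φ ψ f g =>
  ∃ (Z : W.FullSubcategory) (_ : Subsingleton Z.obj.right) (a : φ ⟶ Z) (b : Z ⟶ ψ), f - g = a ≫ b

/-- The category `W` modulo the morphisms that factor through objects `Q → 0` of `W`. -/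
abbrev Bar (W : ObjectProperty (Arrow X.ModΛ)) := CategoryTheory.Quotient (homRel W)

/-- The functor `Cok : W ⥤ V` sending a morphism to its cokernel. -/
def Cok (W : ObjectProperty (Arrow X.ModΛ)) (V : ObjectProperty X.ModΛ)
    (h : ∀ φ : Arrow X.ModΛ, W φ → V ((Limits.coker X.ModΛ).obj φ)) :
    W.FullSubcategory ⥤ V.FullSubcategory :=
  V.lift (W.ι ⋙ Limits.coker X.ModΛ) fun φ => h φ.obj φ.property

lemma Cok_map_eq (W : ObjectProperty (Arrow X.ModΛ)) (V : ObjectProperty X.ModΛ)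
    (h : ∀ φ : Arrow X.ModΛ, W φ → V ((Limits.coker X.ModΛ).obj φ)) (φ ψ : W.FullSubcategory)
    (f g : φ ⟶ ψ) (hfg : homRel W f g) : (Cok W V h).map f = (Cok W V h).map g := by
  obtain ⟨Z, hZ, a, b, hab⟩ := hfg
  have hr : f.hom.right - g.hom.right = 0 := by
    have h1 : (f - g).hom.right = (a ≫ b).hom.right := by rw [hab]
    have h2 : (a ≫ b).hom.right = 0 := by
      have hz : Limits.IsZero Z.obj.right := ModuleCat.isZero_of_subsingleton _
      change a.hom.right ≫ b.hom.right = 0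
      rw [hz.eq_of_tgt a.hom.right 0, Limits.zero_comp]
    rw [h2] at h1
    exact h1
  apply V.ι.map_injective
  change (Limits.coker X.ModΛ).map f.hom = (Limits.coker X.ModΛ).map g.hom
  refine (cancel_epi (Limits.cokernel.π φ.obj.hom)).1 ?_
  have hf := (Limits.coker.π X.ModΛ).naturality f.hom
  have hg := (Limits.coker.π X.ModΛ).naturality g.hom
  refine hf.symm.trans (Eq.trans ?_ hg)
  change f.hom.right ≫ _ = g.hom.right ≫ _
  rw [sub_eq_zero.1 hr]

/-- The functor induced by `Cok` on the quotient category. -/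
def CokBar (W : ObjectProperty (Arrow X.ModΛ)) (V : ObjectProperty X.ModΛ)
    (h : ∀ φ : Arrow X.ModΛ, W φ → V ((Limits.coker X.ModΛ).obj φ)) :
    Bar W ⥤ V.FullSubcategory :=
  CategoryTheory.Quotient.lift (homRel W) (Cok W V h) (Cok_map_eq W V h)

end Extendable

end EquippedPoset

end

/-! Write `e` for `e_0`. Since `0` is the least point and its diagonal space is a division ring, `e
Λ e` is a division ring and `(1 - e) Λ e = 0` (`IsSourceIdem`). Everything follows from these two
facts and from `R_{0,i} ≠ 0` for all `i`.

The key criterion is `injTop_iff`: `N` has injective top iff `N (1 - e) ⊆ rad N`. Such an `N` is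
generated by `N e` (Nakayama), and an `e Λ e`-basis of `N e` gives a surjection from a sum of copies
of `e Λ` that is injective on `e`-parts. Its kernel is killed by `e`, so it is covered by copies of
`(1 - e) Λ`; this presentation is an object of `ℳ`, which gives density.

The functor is full because both terms of an object of `ℳ` are projective. For faithfulness, if two
morphisms agree on cokernels, the difference of their right components has image killed by `e`,
while its source is generated by its `e`-part; so that difference vanishes and only a left component
remains, which factors through some `Q → 0`. Lifting retractions along the functor matches the
summands `e_0 Λ` and `0 → e_0 Λ`, which gives the second equivalence. -/

noncomputable section

namespace EquippedPoset

open MulOpposite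

/-! ### Right ideals generated by idempotents, and Nakayama's lemma over Artinian rings. -/

section Idempotent

variable {L : Type u} [Ring L]

lemma mul_eq_self_of_mem_rightIdeal {e : L} (he : e * e = e) {x : L} (hx : x ∈ rightIdeal e) :
    e * x = x := by
  obtain ⟨a, rfl⟩ := Submodule.mem_span_singleton.1 hx
  rw [← op_unop a, op_smul_eq_mul, ← mul_assoc, he]

lemma mem_rightIdeal_self (e : L) : e ∈ rightIdeal e := Submodule.mem_span_singleton_self e

variable {N : Type*} [AddCommGroup N] [Module Lᵐᵒᵖ N]

/-- The homomorphism of right modules `L → N`, `a ↦ y a`. -/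
def orbitMap (y : N) : L →ₗ[Lᵐᵒᵖ] N where
  toFun a := op a • y
  map_add' a b := by rw [MulOpposite.op_add, add_smul]
  map_smul' c a := by
    rw [RingHom.id_apply, ← op_unop c, op_smul_eq_mul, MulOpposite.op_mul, mul_smul]

@[simp] lemma orbitMap_apply (y : N) (a : L) : orbitMap y a = op a • y := rfl

/-- The right ideal `e L` as a right module. -/
def IdemModule (e : L) : Type u := rightIdeal e

instance (e : L) : AddCommGroup (IdemModule e) := inferInstanceAs (AddCommGroup (rightIdeal e))

instance (e : L) : Module Lᵐᵒᵖ (IdemModule e) := inferInstanceAs (Module Lᵐᵒᵖ (rightIdeal e))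

/-- The homomorphism of right modules `e L → N`, `a ↦ y a`. -/
def idemMap (e : L) (y : N) : IdemModule e →ₗ[Lᵐᵒᵖ] N where
  toFun a := op a.1 • y
  map_add' a b := (orbitMap y).map_add a.1 b.1
  map_smul' c a := (orbitMap y).map_smul c a.1

@[simp] lemma idemMap_apply (e : L) (y : N) (a : IdemModule e) :
    idemMap e y a = op a.1 • y := rfl

/-- The homomorphism from a direct sum of copies of `e L` given by a family of elements. -/
def idemSumMap (e : L) {ν : Type*} (y : ν → N) : (ν →₀ IdemModule e) →ₗ[Lᵐᵒᵖ] N :=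
  Finsupp.lsum ℕ fun i => idemMap e (y i)

lemma idemSumMap_single (e : L) {ν : Type*} (y : ν → N) (i : ν) (a : IdemModule e) :
    idemSumMap e y (Finsupp.single i a) = op a.1 • y i :=
  Finsupp.lsum_single ℕ (fun i => idemMap e (y i)) i a

/-- The idempotent `e` as an element of `e L`. -/
def idemElem (e : L) : IdemModule e := ⟨e, mem_rightIdeal_self e⟩

lemma mul_val {e : L} (he : e * e = e) (a : IdemModule e) : e * a.1 = a.1 :=
  mul_eq_self_of_mem_rightIdeal he a.2

lemma smul_idemElem {e : L} (he : e * e = e) (a : IdemModule e) :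
    op a.1 • idemElem e = a :=
  Subtype.ext (mul_val he a)

lemma projective_idemModule {e : L} (he : e * e = e) :
    Module.Projective Lᵐᵒᵖ (IdemModule e) := by
  refine Module.Projective.of_lifting_property'' fun f hf => ?_
  obtain ⟨y, hy⟩ := hf (idemElem e)
  refine ⟨idemMap e y, LinearMap.ext fun a => ?_⟩
  simp only [LinearMap.comp_apply, idemMap_apply, map_smul, hy, LinearMap.id_apply,
    smul_idemElem he]

lemma projective_finsupp_idemModule {e : L} (he : e * e = e) (ι : Type u) :
    Module.Projective Lᵐᵒᵖ (ι →₀ IdemModule e) := by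
  classical
  have := projective_idemModule he
  exact Module.Projective.of_equiv' (finsuppLequivDFinsupp (M := IdemModule e) (ι := ι) Lᵐᵒᵖ).symm

/-- A nonzero module over an Artinian ring has a maximal submodule. -/
lemma subsingleton_of_jacobson_eq_top {B : Type u} [Ring B] [IsArtinianRing B] (N : Type u)
    [AddCommGroup N] [Module B N] (h : Module.jacobson B N = ⊤) : Subsingleton N := by
  revert h
  refine IsSemiprimaryRing.induction B B N
    (P := fun M _ _ _ => Module.jacobson B M = ⊤ → Subsingleton M) ?_ ?_
  · intro M _ _ _ _ _ _ h
    rw [IsSemisimpleModule.jacobson_eq_bot] at h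
    exact (Submodule.subsingleton_iff B).1 (subsingleton_of_bot_eq_top h)
  -- Here `W` is the ring radical times `M`. The quotient `M ⧸ W` is again its own radical, hence
  -- zero; so `W = M`, and the hypothesis on `W` applies to `M` itself.
  · intro M _ _ _ _ W hW hQ h
    have h1 : Module.jacobson B (M ⧸ W) = ⊤ := by
      rw [Module.jacobson_quotient_of_le (Ring.jacobson_smul_top_le B M), h]
      exact (Submodule.map_top _).trans W.range_mkQ
    have h2 : W = ⊤ := Submodule.Quotient.subsingleton_iff.1 (hQ h1)
    have f : W ≃ₗ[B] M := (LinearEquiv.ofEq _ _ h2).trans Submodule.topEquiv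
    refine f.symm.toEquiv.subsingleton_congr.2 (hW ?_)
    rw [← Module.map_jacobson_of_bijective f.symm.bijective, h]
    exact (Submodule.map_top _).trans (LinearMap.range_eq_top.2 f.symm.surjective)

/-- If `N = W + rad N`, then `N = W`. -/
lemma eq_top_of_sup_jacobson {B : Type u} [Ring B] [IsArtinianRing B] {N : Type u}
    [AddCommGroup N] [Module B N] {W : Submodule B N} (h : W ⊔ Module.jacobson B N = ⊤) :
    W = ⊤ := by
  refine Submodule.Quotient.subsingleton_iff.1 (subsingleton_of_jacobson_eq_top (B := B) _
    (top_le_iff.1 ?_))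
  refine le_trans ?_ (Module.map_jacobson_le W.mkQ)
  rintro x -
  obtain ⟨x, rfl⟩ := W.mkQ_surjective x
  obtain ⟨w, hw, r, hr, rfl⟩ := Submodule.mem_sup.1 (h.ge (Submodule.mem_top (x := x)))
  refine ⟨r, hr, ?_⟩
  rw [map_add, show W.mkQ w = 0 from (Submodule.Quotient.mk_eq_zero W).2 hw, zero_add]

end Idempotent

/-- The subgroup `N e` of the right module `N`. -/
def fixedSubgroup {L : Type u} [Ring L] (e : L) (N : Type*) [AddCommGroup N]
    [Module Lᵐᵒᵖ N] : AddSubgroup N where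
  carrier := {y | op e • y = y}
  zero_mem' := smul_zero _
  add_mem' {x y} hx hy := by
    change op e • (x + y) = x + y
    rw [smul_add, show op e • x = x from hx, show op e • y = y from hy]
  neg_mem' {x} hx := by
    change op e • (-x) = -x
    rw [smul_neg, show op e • x = x from hx]

lemma one_sub_smul_of_smul_eq_zero {L N : Type*} [Ring L] [AddCommGroup N] [Module Lᵐᵒᵖ N] {e : L}
    {x : N} (hx : op e • x = 0) : op (1 - e) • x = x := by
  rw [MulOpposite.op_sub, op_one, sub_smul, one_smul, hx, sub_zero]

/-- An idempotent `e` of `L` such that `e L e` is a division ring and `(1 - e) L e = 0`. -/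
structure IsSourceIdem {L : Type u} [Ring L] (e : L) : Prop where
  idem : e * e = e
  ne_zero : e ≠ 0
  source : ∀ a, a * e = e * a * e
  exists_inv : ∀ a, e * a * e ≠ 0 → ∃ b, e * a * e * b = e ∧ b * (e * a * e) = e

/-! ### Modules over a ring with a source idempotent: radicals, injectivity, presentations. -/

namespace IsSourceIdem

variable {L : Type u} [Ring L] {e : L} (H : IsSourceIdem e)
include H

section Module

variable {N : Type*} [AddCommGroup N] [Module Lᵐᵒᵖ N]

/-- With `n = e a (1 - e)`, the relation `(1 - e) L e = 0` gives `n L n = 0`. If a maximal `C`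
missed `x n`, then `x = c + x n l` with `c ∈ C`, and multiplying by `n` puts `x n = c n` in `C`. -/
lemma smul_mem_jacobson (a : L) (x : N) :
    op (e * a * (1 - e)) • x ∈ Module.jacobson Lᵐᵒᵖ N := by
  refine Submodule.mem_sInf.2 fun C hC => ?_
  by_contra hx
  have h : C ⊔ Submodule.span Lᵐᵒᵖ {op (e * a * (1 - e)) • x} = ⊤ :=
    hC.2 _ (lt_of_le_of_ne le_sup_left fun h =>
      hx (h.ge (le_sup_right (a := C) (Submodule.mem_span_singleton_self _))))
  obtain ⟨c, hc, y, hy, hcy⟩ := Submodule.mem_sup.1 (h.ge (Submodule.mem_top (x := x)))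
  obtain ⟨l, rfl⟩ := Submodule.mem_span_singleton.1 hy
  have h0 : op (e * a * (1 - e)) * (l * op (e * a * (1 - e))) = 0 := by
    apply unop_injective
    have h1 : (1 - e) * (l.unop * e) = 0 := by
      rw [H.source l.unop, sub_mul, one_mul, ← mul_assoc, ← mul_assoc, H.idem, sub_self]
    calc e * a * (1 - e) * l.unop * (e * a * (1 - e))
        = e * a * ((1 - e) * (l.unop * e)) * (a * (1 - e)) := by simp only [mul_assoc]
      _ = 0 := by rw [h1, mul_zero, zero_mul]
  refine hx ?_
  rw [← hcy, smul_add]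
  refine add_mem (C.smul_mem _ hc) ?_
  rw [smul_smul, smul_smul, mul_assoc, h0, zero_smul]
  exact zero_mem _

lemma smul_smul_self (x : N) : op e • op e • x = op e • x := by
  rw [smul_smul, ← op_mul, H.idem]

/-- On each summand `a (1 - e)` is the generator times `e a (1 - e)`. Hence every map from a module
killed by `e` into a sum of copies of `e L` lands in the radical. -/
lemma smul_finsupp_mem_jacobson {ν : Type*} (f : ν →₀ IdemModule e) :
    op (1 - e) • f ∈ Module.jacobson Lᵐᵒᵖ (ν →₀ IdemModule e) := by
  induction f using Finsupp.induction_linear with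
  | zero => rw [smul_zero]; exact zero_mem _
  | add f g hf hg =>
    rw [smul_add]
    exact add_mem hf hg
  | single i a =>
    have h : op (1 - e) • Finsupp.single i a
        = op (e * a.1 * (1 - e)) • Finsupp.single i (idemElem e) := by
      rw [mul_val H.idem a, Finsupp.smul_single, Finsupp.smul_single,
        MulOpposite.op_mul, mul_smul, smul_idemElem H.idem]
    rw [h]
    exact H.smul_mem_jacobson _ _

lemma smul_idemModule_one_sub (a : IdemModule (1 - e)) : op e • a = 0 := by
  have he : (1 - e) * (1 - e) = 1 - e := by
    rw [mul_sub, mul_one, sub_mul, one_mul, H.idem, sub_self, sub_zero]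
  refine Subtype.ext ?_
  change a.1 * e = 0
  rw [← mul_val he a, mul_assoc, H.source, sub_mul, one_mul, ← mul_assoc,
    ← mul_assoc, H.idem, sub_self]

/-- A module on which `e` acts as the identity is injective. -/
lemma injective_of_smul_eq {T : Type u} [AddCommGroup T] [Module Lᵐᵒᵖ T]
    (hT : ∀ t : T, op e • t = t) : Module.Injective Lᵐᵒᵖ T := by
  refine Module.Baer.injective fun I g => ?_
  -- Baer's criterion: `g x = (g x) e = g (x e)`, so `g` depends only on `I e`. Either `I e = 0` and
  -- `g = 0`, or inverting a nonzero `a e = e a e` gives `e ∈ I`, and `x ↦ g(e) x` extends `g`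
  -- because `x e = e x e`.
  by_cases hI : ∀ a ∈ I, op e * a = 0
  · refine ⟨0, fun x hx => ?_⟩
    rw [← hT (g ⟨x, hx⟩), ← map_smul]
    have : op e • (⟨x, hx⟩ : I) = 0 := Subtype.ext (hI x hx)
    rw [this, map_zero, LinearMap.zero_apply]
  · push Not at hI
    obtain ⟨a, ha, hne⟩ := hI
    have h1 : e * a.unop * e ≠ 0 := by
      rw [← H.source]
      exact fun h => hne (unop_injective h)
    obtain ⟨b, hb, -⟩ := H.exists_inv _ h1
    have he : op e ∈ I := by
      have : op e = op b * (op e * a) := by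
        apply unop_injective
        change e = a.unop * e * b
        rw [H.source, hb]
      rw [this]
      exact I.mul_mem_left _ (I.mul_mem_left _ ha)
    refine ⟨LinearMap.toSpanSingleton Lᵐᵒᵖ T (g ⟨op e, he⟩), fun x hx => ?_⟩
    rw [LinearMap.toSpanSingleton_apply, ← map_smul, ← hT (g ⟨x, hx⟩), ← hT (g _), ← map_smul,
      ← map_smul]
    congr 1
    refine Subtype.ext ?_
    change op e * (x * op e) = op e * x
    apply unop_injective
    change e * x.unop * e = x.unop * e
    rw [← H.source]

end Module

lemma injective_quotient_jacobson {N : Type u} [AddCommGroup N] [Module Lᵐᵒᵖ N]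
    (hN : ∀ x : N, op (1 - e) • x ∈ Module.jacobson Lᵐᵒᵖ N) :
    Module.Injective Lᵐᵒᵖ (N ⧸ Module.jacobson Lᵐᵒᵖ N) := by
  refine H.injective_of_smul_eq fun t => ?_
  obtain ⟨x, rfl⟩ := (Module.jacobson Lᵐᵒᵖ N).mkQ_surjective t
  rw [← map_smul]
  refine ((Submodule.Quotient.eq _).2 ?_).symm
  rw [← one_smul Lᵐᵒᵖ x, smul_smul, mul_one, ← sub_smul]
  exact hN x

/-- The division ring `e L e`. -/
abbrev Corner : Type u := (show IsIdempotentElem e from H.idem).Corner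

instance : DivisionRing H.Corner :=
  haveI : Nontrivial H.Corner := ⟨1, 0, fun h => H.ne_zero (congrArg Subtype.val h)⟩
  DivisionRing.ofIsUnitOrEqZero fun ⟨x, hx⟩ => by
    obtain ⟨a, rfl⟩ := hx
    by_cases h : e * a * e = 0
    · exact Or.inr (Subtype.ext h)
    · left
      obtain ⟨b, hb, hb'⟩ := H.exists_inv a h
      refine ⟨⟨⟨e * a * e, a, rfl⟩, ⟨e * b * e, b, rfl⟩, Subtype.ext ?_, Subtype.ext ?_⟩, rfl⟩
      · change e * a * e * (e * b * e) = e
        calc e * a * e * (e * b * e) = e * a * (e * e) * b * e := by simp only [mul_assoc]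
          _ = e := by rw [H.idem, hb, H.idem]
      · change e * b * e * (e * a * e) = e
        calc e * b * e * (e * a * e) = e * (b * ((e * e) * a * e)) := by simp only [mul_assoc]
          _ = e := by rw [H.idem, hb', H.idem]

section Cover

variable (N : Type u) [AddCommGroup N] [Module Lᵐᵒᵖ N]

instance : Module H.Cornerᵐᵒᵖ (fixedSubgroup e N) where
  smul d v := ⟨op d.unop.1 • v.1, by
    obtain ⟨a, ha⟩ := d.unop.2
    change op e • op d.unop.1 • v.1 = _
    rw [smul_smul, ← op_mul, ← ha, mul_assoc _ e e, H.idem]⟩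
  one_smul v := Subtype.ext v.2
  mul_smul c d v := Subtype.ext (mul_smul (op c.unop.1) (op d.unop.1) v.1)
  smul_zero d := Subtype.ext (smul_zero (op d.unop.1))
  smul_add d v w := Subtype.ext (smul_add (op d.unop.1) v.1 w.1)
  add_smul c d v := Subtype.ext (add_smul (op c.unop.1) (op d.unop.1) v.1)
  zero_smul v := Subtype.ext (zero_smul Lᵐᵒᵖ v.1)

lemma coe_corner_smul (d : H.Cornerᵐᵒᵖ) (v : fixedSubgroup e N) :
    ((d • v : fixedSubgroup e N) : N) = op (d.unop.1 : L) • (v : N) := rfl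

/-- A module generated by `N e` is a quotient of a direct sum of copies of `e L` by a submodule
`U` with `U e = 0`. -/
lemma exists_cover (hN : Submodule.span Lᵐᵒᵖ (fixedSubgroup e N : Set N) = ⊤) :
    ∃ (ν : Type u) (π : (ν →₀ IdemModule e) →ₗ[Lᵐᵒᵖ] N), Function.Surjective π ∧
      ∀ f, π f = 0 → op e • f = 0 := by
  let b := Module.Basis.ofVectorSpace H.Cornerᵐᵒᵖ (fixedSubgroup e N)
  let ν := Module.Basis.ofVectorSpaceIndex H.Cornerᵐᵒᵖ (fixedSubgroup e N)
  let π : (ν →₀ IdemModule e) →ₗ[Lᵐᵒᵖ] N := idemSumMap e fun i => (b i : N)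
  have hπ : ∀ i a, π (Finsupp.single i a) = op a.1 • (b i : N) := fun i a =>
    idemSumMap_single e _ i a
  refine ⟨ν, π, ?_, fun f hf => ?_⟩
  · rw [← LinearMap.range_eq_top, ← top_le_iff, ← hN, Submodule.span_le]
    -- The part of `N e` in the range of `π` is an `e L e`-subspace containing the basis.
    let W : Submodule H.Cornerᵐᵒᵖ (fixedSubgroup e N) :=
      { carrier := {v | (v : N) ∈ LinearMap.range π}
        zero_mem' := zero_mem (LinearMap.range π)
        add_mem' := fun hx hy => (LinearMap.range π).add_mem hx hy
        smul_mem' := fun d v hv => (LinearMap.range π).smul_mem (op d.unop.1) hv }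
    have hW : W = ⊤ := by
      rw [← top_le_iff, ← b.span_eq, Submodule.span_le]
      rintro _ ⟨i, rfl⟩
      exact ⟨Finsupp.single i (idemElem e), (hπ _ _).trans (b i).2⟩
    exact fun v hv => hW.ge (Submodule.mem_top (x := (⟨v, hv⟩ : fixedSubgroup e N)))
  -- The entries of `f e` lie in `e L e` and are the coordinates of `π (f e)` in the basis `b`; so
  -- `π f = 0` forces them to vanish.
  · let τ : IdemModule e → H.Cornerᵐᵒᵖ := fun x => op ⟨e * x.1 * e, x.1, rfl⟩
    have hτ : τ 0 = 0 := by
      apply unop_injective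
      refine Subtype.ext ?_
      change e * 0 * e = 0
      rw [mul_zero, zero_mul]
    let c : ν →₀ H.Cornerᵐᵒᵖ := (op e • f).mapRange τ hτ
    have hval : ∀ g : ν →₀ IdemModule e,
        ((Finsupp.linearCombination H.Cornerᵐᵒᵖ b ((op e • g).mapRange τ hτ) : fixedSubgroup e N) : N)
          = π (op e • g) := by
      intro g
      induction g using Finsupp.induction_linear with
      | zero => simp
      | add g g' hg hg' =>
        rw [smul_add, Finsupp.mapRange_add, map_add, map_add, AddSubgroup.coe_add, hg, hg']
        intro x y
        apply unop_injective
        exact Subtype.ext (by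
          change e * (x.1 + y.1) * e = e * x.1 * e + e * y.1 * e
          rw [mul_add, add_mul])
      | single i a =>
        rw [Finsupp.smul_single, Finsupp.mapRange_single, Finsupp.linearCombination_single, hπ,
          coe_corner_smul]
        change op (e * (a.1 * e) * e) • _ = op (a.1 * e) • _
        rw [← mul_assoc, mul_val H.idem a, mul_assoc, H.idem]
    have h0 : Finsupp.linearCombination H.Cornerᵐᵒᵖ b c = 0 := Subtype.ext (by
      rw [hval, map_smul, hf, smul_zero]; rfl)
    have hc : c = 0 := linearIndependent_iff.1 b.linearIndependent c h0
    ext i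
    have h1 := DFunLike.congr_fun hc i
    have h2 : e * ((f i).1 * e) * e = 0 := congrArg (fun d : H.Cornerᵐᵒᵖ => d.unop.1) h1
    rw [← mul_assoc, mul_val H.idem (f i), mul_assoc, H.idem] at h2
    exact Subtype.ext h2

end Cover

/-- A module whose elements `x` satisfy `x (1 - e) ∈ rad N` is the cokernel of a map of
projective modules `φ : P → (e L)^(ν)` with `P e = 0`. -/
lemma exists_presentation [IsArtinianRing Lᵐᵒᵖ] (N : Type u) [AddCommGroup N] [Module Lᵐᵒᵖ N]
    (hN : ∀ x : N, op (1 - e) • x ∈ Module.jacobson Lᵐᵒᵖ N) :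
    ∃ (ν κ : Type u) (φ : (κ →₀ IdemModule (1 - e)) →ₗ[Lᵐᵒᵖ] (ν →₀ IdemModule e))
      (π : (ν →₀ IdemModule e) →ₗ[Lᵐᵒᵖ] N), Function.Surjective π ∧ Function.Exact φ π := by
  have hgen : Submodule.span Lᵐᵒᵖ (fixedSubgroup e N : Set N) = ⊤ := by
    refine eq_top_of_sup_jacobson (top_le_iff.1 fun x _ => ?_)
    have hx : op e • x + op (1 - e) • x = x := by
      rw [← add_smul, ← MulOpposite.op_add, add_sub_cancel, op_one, one_smul]
    rw [← hx]
    exact Submodule.add_mem_sup (Submodule.subset_span (H.smul_smul_self x)) (hN x)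
  obtain ⟨ν, π, hπ, hker⟩ := H.exists_cover N hgen
  -- One copy of `(1 - e) L` for every element `k` of the kernel; its generator goes to `k (1 - e) =
  -- k`.
  refine ⟨ν, LinearMap.ker π, idemSumMap (1 - e) fun k => (k : ν →₀ IdemModule e), π, hπ,
    fun f => ⟨fun hf => ?_, ?_⟩⟩
  · refine ⟨Finsupp.single ⟨f, hf⟩ (idemElem (1 - e)), ?_⟩
    have : op (1 - e) • f = f := one_sub_smul_of_smul_eq_zero (hker f hf)
    rwa [idemSumMap_single]
  · rintro ⟨g, rfl⟩
    induction g using Finsupp.induction_linear with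
    | zero => simp
    | add g g' hg hg' => rw [map_add, map_add, hg, hg', add_zero]
    | single k a =>
      rw [idemSumMap_single, map_smul, show π (k : ν →₀ IdemModule e) = 0 from k.2, smul_zero]

end IsSourceIdem

/-! ### Matrix units of incidence algebras, and their injective modules. -/

namespace MultSystem

variable {K A P : Type u} [Field K] [Ring A] [Algebra K A] [PartialOrder P]
  [Fintype P] [DecidableEq P] (R : MultSystem K A P)

instance [FiniteDimensional K A] : IsArtinianRing R.Lamᵐᵒᵖ := by
  have h : FiniteDimensional K R.Lam :=
    inferInstanceAs (FiniteDimensional K R.incidenceSubalgebra.toSubmodule)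
  have : FiniteDimensional K R.Lamᵐᵒᵖ :=
    Module.Finite.equiv (MulOpposite.opLinearEquiv K (M := R.Lam))
  exact isArtinian_of_tower K inferInstance

variable {R}

/-- The matrix with the single nonzero entry `r ∈ R_{i,j}`. -/
def unitMatrix {i j : P} (hij : i ≤ j) {r : A} (hr : r ∈ R.space i j) : R.Lam :=
  ⟨Matrix.single i j r, by
    refine ⟨fun k l _ => ?_, fun k l h => ?_⟩
    · by_cases h : i = k ∧ j = l
      · obtain ⟨rfl, rfl⟩ := h
        simpa using hr
      · rw [Matrix.single_apply, if_neg h]; exact zero_mem _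
    · rw [Matrix.single_apply, if_neg]
      rintro ⟨rfl, rfl⟩
      exact h hij⟩

lemma e_eq_unitMatrix (i : P) : R.e i = unitMatrix le_rfl (R.one_mem i) := rfl

lemma unitMatrix_mul_unitMatrix {i j k : P} (hij : i ≤ j) (hjk : j ≤ k) {r s : A}
    (hr : r ∈ R.space i j) (hs : s ∈ R.space j k) :
    unitMatrix hij hr * unitMatrix hjk hs
      = unitMatrix (hij.trans hjk) (R.mul_mem hij hjk hr hs) :=
  Subtype.ext (Matrix.single_mul_single_same ..)

lemma e_mul_unitMatrix {i j : P} (hij : i ≤ j) {r : A} (hr : r ∈ R.space i j) :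
    R.e i * unitMatrix hij hr = unitMatrix hij hr := by
  refine Subtype.ext ((Matrix.single_mul_single_same ..).trans ?_)
  rw [R.one_mul hij hr]; rfl

lemma unitMatrix_mul_e {i j : P} (hij : i ≤ j) {r : A} (hr : r ∈ R.space i j) :
    unitMatrix hij hr * R.e j = unitMatrix hij hr := by
  refine Subtype.ext ((Matrix.single_mul_single_same ..).trans ?_)
  rw [R.mul_one hij hr]; rfl

lemma unitMatrix_mul_e_of_ne {i j k : P} (hij : i ≤ j) {r : A} (hr : r ∈ R.space i j)
    (hk : j ≠ k) : unitMatrix hij hr * R.e k = 0 :=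
  Subtype.ext (Matrix.single_mul_single_of_ne (h := hk) ..)

lemma e_mul_e (i : P) : R.e i * R.e i = R.e i := e_mul_unitMatrix le_rfl (R.one_mem i)

lemma sum_e : ∑ i, R.e i = 1 := by
  have h : ∀ s : Finset P, (∑ i ∈ s, R.e i).1 = ∑ i ∈ s, Matrix.single i i (R.one i) := fun s => by
    induction s using Finset.induction_on with
    | empty => rfl
    | insert i s hi ih =>
      rw [Finset.sum_insert hi, Finset.sum_insert hi, ← ih]; rfl
  refine Subtype.ext ((h _).trans ?_)
  exact Matrix.sum_single_eq_diagonal _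

lemma e_mul_mul_e_of_le {i j : P} (hij : i ≤ j) (a : R.Lam) :
    R.e i * a * R.e j = unitMatrix hij (a.2.1 i j hij) := by
  refine Subtype.ext ((Matrix.single_mul_mul_single ..).trans ?_)
  rw [R.one_mul hij (a.2.1 i j hij), R.mul_one hij (a.2.1 i j hij)]; rfl

lemma e_mul_mul_e_of_not_le {i j : P} (hij : ¬ i ≤ j) (a : R.Lam) :
    R.e i * a * R.e j = 0 := by
  refine Subtype.ext ((Matrix.single_mul_mul_single ..).trans ?_)
  rw [a.2.2 i j hij, mul_zero, zero_mul, Matrix.single_zero]; rfl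

lemma unitMatrix_congr {i j : P} (hij : i ≤ j) {r s : A} (h : r = s) (hr : r ∈ R.space i j)
    (hs : s ∈ R.space i j) : unitMatrix hij hr = unitMatrix hij hs := by subst h; rfl

lemma unitMatrix_eq_zero {i j : P} (hij : i ≤ j) {r : A} (h : r = 0) (hr : r ∈ R.space i j) :
    unitMatrix hij hr = 0 := by
  subst h; exact Subtype.ext (Matrix.single_zero i j)

lemma eq_zero_of_unitMatrix_eq_zero {i j : P} (hij : i ≤ j) {r : A} {hr : r ∈ R.space i j}
    (h : unitMatrix hij hr = 0) : r = 0 := by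
  have h1 := congrFun (congrFun (congrArg Subtype.val h) i) j
  exact (Matrix.single_apply_same i j r).symm.trans h1

/-- `R_i` is a division ring. -/
def IsDivision (R : MultSystem K A P) (i : P) : Prop :=
  R.one i ≠ 0 ∧ ∀ x ∈ R.space i i, x ≠ 0 → ∃ y ∈ R.space i i, x * y = R.one i ∧ y * x = R.one i

/-- The idempotent of a least point whose diagonal space is a division ring. -/
lemma isSourceIdem_e [OrderBot P] (h : R.IsDivision ⊥) : IsSourceIdem (R.e ⊥) where
  idem := e_mul_e ⊥
  ne_zero h0 := h.1 (eq_zero_of_unitMatrix_eq_zero le_rfl (hr := R.one_mem ⊥) h0)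
  source a := by
    conv_lhs => rw [← _root_.one_mul a, ← sum_e, Finset.sum_mul, Finset.sum_mul]
    refine Finset.sum_eq_single ⊥ (fun i _ hi => ?_) fun hi => absurd (Finset.mem_univ _) hi
    exact e_mul_mul_e_of_not_le (fun h => hi (le_bot_iff.1 h)) a
  exists_inv a ha := by
    rw [e_mul_mul_e_of_le le_rfl] at ha ⊢
    obtain ⟨y, hy, h1, h2⟩ := h.2 _ (a.2.1 ⊥ ⊥ le_rfl) fun h0 => ha (unitMatrix_eq_zero _ h0 _)
    refine ⟨unitMatrix le_rfl hy, ?_, ?_⟩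
    · exact (unitMatrix_mul_unitMatrix ..).trans (unitMatrix_congr _ h1 _ (R.one_mem ⊥))
    · exact (unitMatrix_mul_unitMatrix ..).trans (unitMatrix_congr _ h2 _ (R.one_mem ⊥))

/-- If all `R_i` are division rings and `R_{0,i} ≠ 0` for all `i`, then an injective module
annihilated by `e_0 Λ (1 - e_0)` is annihilated by `1 - e_0`. -/
lemma smul_e_eq_of_injective [OrderBot P] (hdiv : ∀ i, R.IsDivision i)
    (hne : ∀ i, ∃ x ∈ R.space ⊥ i, x ≠ 0) {T : Type u} [AddCommGroup T] [Module R.Lamᵐᵒᵖ T]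
    [Module.Injective R.Lamᵐᵒᵖ T] (hT : ∀ (a : R.Lam) (t : T), op (R.e ⊥ * a * (1 - R.e ⊥)) • t = 0)
    (t : T) : op (R.e ⊥) • t = t := by
  have hsum : ∀ t : T, ∑ i, op (R.e i) • t = t := fun t => by
    rw [← Finset.sum_smul, ← Finset.op_sum, sum_e, op_one, one_smul]
  -- Induction from the top of the poset down: `T e_j = 0` is known for all `j > i`.
  have key : ∀ i, i ≠ ⊥ → ∀ t : T, op (R.e i) • t = 0 := by
    intro i
    induction i using WellFoundedGT.induction with
    | ind i ih =>
      intro hi t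
      obtain ⟨x, hx, hx0⟩ := hne i
      let X : R.Lam := unitMatrix bot_le hx
      let m : R.Lam →ₗ[R.Lamᵐᵒᵖ] R.Lam := orbitMap X
      let s : R.Lam →ₗ[R.Lamᵐᵒᵖ] T := orbitMap (op (R.e i) • t)
      -- This makes `X a ↦ t e_i a` well defined on `X Λ`. If `X a = 0`, then `a_{i,i} = 0`, since
      -- inverting it would give `X = 0`; the remaining terms `t e_i a e_j`, `j > i`, vanish by
      -- induction.
      have hker : LinearMap.ker m ≤ LinearMap.ker s := by
        intro a ha
        have ha' : X * a = 0 := ha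
        have hii : a.1 i i = 0 := by
          by_contra h0
          obtain ⟨y, hy, h1, -⟩ := (hdiv i).2 _ (a.2.1 i i le_rfl) h0
          refine hx0 (eq_zero_of_unitMatrix_eq_zero (R := R) bot_le (hr := hx) ?_)
          change X = 0
          calc X = X * R.e i := (unitMatrix_mul_e _ _).symm
            _ = X * (unitMatrix le_rfl (a.2.1 i i le_rfl) * unitMatrix le_rfl hy) := by
              rw [unitMatrix_mul_unitMatrix, e_eq_unitMatrix]
              exact congrArg _ (unitMatrix_congr _ h1.symm _ _)
            _ = X * a * R.e i * unitMatrix le_rfl hy := by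
              rw [← e_mul_mul_e_of_le le_rfl]
              simp only [← mul_assoc]
              rw [show X * R.e i = X from unitMatrix_mul_e _ _]
            _ = 0 := by rw [ha', zero_mul, zero_mul]
        change op a • op (R.e i) • t = 0
        rw [← hsum (op a • op (R.e i) • t)]
        refine Finset.sum_eq_zero fun j _ => ?_
        by_cases hij : i ≤ j
        · rcases hij.eq_or_lt with rfl | hlt
          · rw [smul_smul, smul_smul, ← op_mul, ← op_mul, ← mul_assoc,
              e_mul_mul_e_of_le le_rfl, unitMatrix_eq_zero _ hii, op_zero, zero_smul]
          · exact ih j hlt (fun h => not_lt_bot (h ▸ hlt)) _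
        · rw [smul_smul, smul_smul, ← op_mul, ← op_mul, ← mul_assoc,
              e_mul_mul_e_of_not_le hij, op_zero, zero_smul]
      obtain ⟨h, hh⟩ := Module.Injective.out ((LinearMap.ker m).liftQ m le_rfl)
        (LinearMap.ker_eq_bot.1 (Submodule.ker_liftQ_eq_bot _ _ _ le_rfl))
        ((LinearMap.ker m).liftQ s hker)
      have h1 : h X = op (R.e i) • t := by
        have := hh (Submodule.Quotient.mk 1)
        rw [Submodule.liftQ_apply, Submodule.liftQ_apply, orbitMap_apply, orbitMap_apply, op_one,
          one_smul, one_smul] at this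
        exact this
      -- The extension `h` sends `X` to `t e_i`, but also to `h(1) X`, which is zero because `X ∈
      -- e_0 Λ (1 - e_0)`.
      have h2 : X = R.e ⊥ * X * (1 - R.e ⊥) := by
        rw [mul_sub, _root_.mul_one, e_mul_unitMatrix, unitMatrix_mul_e_of_ne _ _ hi, sub_zero]
      have h3 : X = op (R.e ⊥ * X * (1 - R.e ⊥)) • (1 : R.Lam) := by
        rw [← h2, op_smul_eq_mul, _root_.one_mul]
      rw [← h1, h3, map_smul, hT]
  conv_rhs => rw [← hsum t]
  exact (Finset.sum_eq_single ⊥ (fun i _ hi => key i hi t)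
    fun hi => absurd (Finset.mem_univ _) hi).symm

end MultSystem

/-! ### The idempotent `e_0` of `Λ` and the criterion for an injective top. -/

namespace Extendable

variable {K A P : Type u} [Field K] [Ring A] [Algebra K A] [PartialOrder P]
  [Fintype P] [DecidableEq P] {T : MultSystem K A P} (X : Extendable T)

lemma isDivision_fullSystem (i : WithBot (WithTop P)) : X.fullSystem.IsDivision i := by
  induction i using WithBot.recBotCoe with
  | bot => exact ⟨X.admissible.one_ne_zero ⊤, X.admissible.exists_inv ⊤⟩
  | coe i => exact ⟨X.admissible.one_ne_zero i, X.admissible.exists_inv i⟩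

/-- The nonzero cyclic module `ε_i A` has a simple quotient, necessarily isomorphic to `ε_m A`; the
image of `ε_i` there is the required `z`. This shows `R_{0,i} ≠ 0`. -/
lemma exists_mul_ε_ne_zero (i : WithTop P) : ∃ z : A, X.ε ⊤ * z * X.ε i ≠ 0 := by
  have hi : X.ε i ≠ 0 := X.admissible.one_ne_zero i
  have hid : idemElem (X.ε i) ≠ 0 := fun h => hi (congrArg Subtype.val h)
  have : Nontrivial (IdemModule (X.ε i)) := ⟨_, _, hid⟩
  have hspan : ∀ x : IdemModule (X.ε i), op x.1 • idemElem (X.ε i) = x :=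
    smul_idemElem (X.idem i)
  have : Module.Finite Aᵐᵒᵖ (IdemModule (X.ε i)) :=
    ⟨⟨{idemElem (X.ε i)}, top_le_iff.1 fun x _ => by
      rw [Finset.coe_singleton]
      exact Submodule.mem_span_singleton.2 ⟨_, hspan x⟩⟩⟩
  obtain ⟨C, hC⟩ := IsCoatomic.exists_coatom (α := Submodule Aᵐᵒᵖ (IdemModule (X.ε i)))
  have := isSimpleModule_iff_isCoatom.2 hC
  obtain ⟨g⟩ := X.unique (IdemModule (X.ε i) ⧸ C)
  have := X.simple
  let z : IdemModule (X.ε ⊤) := g (C.mkQ (idemElem (X.ε i)))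
  have hz : ∀ x, (g (C.mkQ x) : rightIdeal (X.ε ⊤)) = op x.1 • z := fun x => by
    conv_lhs => rw [← hspan x, map_smul, map_smul]
    rfl
  refine ⟨z.1, fun h0 => ?_⟩
  have h1 : z.1 * X.ε i = 0 := by
    rwa [mul_val (X.idem ⊤)] at h0
  have h2 : op (X.ε i) • z = 0 := Subtype.ext h1
  have h3 : g (C.mkQ (idemElem (X.ε i))) = 0 := (hz _).trans h2
  have h4 : idemElem (X.ε i) ∈ C :=
    (Submodule.Quotient.mk_eq_zero C).1 ((LinearEquiv.map_eq_zero_iff g).1 h3)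
  refine hC.1 (top_le_iff.1 fun x _ => ?_)
  rw [← hspan x]
  exact C.smul_mem _ h4

lemma isSourceIdem_e0 : IsSourceIdem X.e0 :=
  MultSystem.isSourceIdem_e (X.isDivision_fullSystem ⊥)

/-- The top has zero radical, so `e_0 Λ (1 - e_0)` kills it by `smul_mem_jacobson`; if it is
injective, `smul_e_eq_of_injective` makes `e_0` act on it as the identity. The converse is the Baer
argument. -/
lemma injTop_iff (N : X.ModΛ) :
    X.InjTop N ↔ ∀ x : N, op (1 - X.e0) • x ∈ Module.jacobson X.Λᵐᵒᵖ N := by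
  refine ⟨fun hN x => ?_, X.isSourceIdem_e0.injective_quotient_jacobson⟩
  have : Module.Injective X.Λᵐᵒᵖ (N ⧸ Module.jacobson X.Λᵐᵒᵖ N) := hN
  have h := MultSystem.smul_e_eq_of_injective (R := X.fullSystem) X.isDivision_fullSystem
    (fun i => ?_) (T := N ⧸ Module.jacobson X.Λᵐᵒᵖ N) (fun a t => ?_)
    ((Module.jacobson X.Λᵐᵒᵖ N).mkQ x)
  · rw [← Submodule.Quotient.mk_eq_zero, MulOpposite.op_sub, op_one, sub_smul, one_smul,
      Submodule.Quotient.mk_sub]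
    exact sub_eq_zero.2 h.symm
  · induction i using WithBot.recBotCoe with
    | bot => exact ⟨_, X.fullSystem.one_mem ⊥, (X.isDivision_fullSystem ⊥).1⟩
    | coe i =>
      obtain ⟨z, hz⟩ := X.exists_mul_ε_ne_zero i
      exact ⟨_, ⟨z, Submodule.mem_top, rfl⟩, fun h => hz ((mul_assoc ..).trans h)⟩
  · have h := X.isSourceIdem_e0.smul_mem_jacobson a t
    rw [Module.jacobson_quotient_jacobson] at h
    exact h

end Extendable

open Limits

/-! ### Cokernels of module homomorphisms and lifting of maps between them. -/

section Coker

variable {B : Type u} [Ring B]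

/-- The projection onto the cokernel. -/
def cokerπ (φ : Arrow (ModuleCat.{u} B)) : φ.right →ₗ[B] (coker (ModuleCat.{u} B)).obj φ :=
  (cokernel.π φ.hom).hom

lemma cokerπ_surjective (φ : Arrow (ModuleCat.{u} B)) : Function.Surjective (cokerπ φ) :=
  (ModuleCat.epi_iff_surjective (cokernel.π φ.hom)).1 inferInstance

lemma cokerπ_apply_eq_zero_iff (φ : Arrow (ModuleCat.{u} B)) (x : φ.right) :
    cokerπ φ x = 0 ↔ ∃ y, φ.hom.hom y = x := by
  have h := (ShortComplex.moduleCat_exact_iff _).1 (ShortComplex.exact_cokernel φ.hom)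
  refine ⟨fun hx => h x hx, ?_⟩
  rintro ⟨y, rfl⟩
  exact congrArg (fun f => f.hom y) (cokernel.condition φ.hom)

lemma coker_map_cokerπ {φ ψ : Arrow (ModuleCat.{u} B)} (f : φ ⟶ ψ) (x : φ.right) :
    ((coker (ModuleCat.{u} B)).map f).hom (cokerπ φ x) = cokerπ ψ (f.right.hom x) :=
  (congrArg (fun f => f.hom x) ((coker.π (ModuleCat.{u} B)).naturality f)).symm

/-- Source of fullness: projectivity of `φ.right` lifts `g` through the cokernel projection of `ψ`,
and projectivity of `φ.left` then lifts through `ψ` onto its image. -/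
lemma coker_map_surjective {φ ψ : Arrow (ModuleCat.{u} B)} [Module.Projective B φ.left]
    [Module.Projective B φ.right] (g : (coker (ModuleCat.{u} B)).obj φ ⟶
      (coker (ModuleCat.{u} B)).obj ψ) :
    ∃ f : φ ⟶ ψ, (coker (ModuleCat.{u} B)).map f = g := by
  obtain ⟨r, hr⟩ := Module.projective_lifting_property (cokerπ ψ)
    (g.hom ∘ₗ cokerπ φ) (cokerπ_surjective ψ)
  have hr' : ∀ x, cokerπ ψ (r x) = g.hom (cokerπ φ x) :=
    fun x => DFunLike.congr_fun hr x
  have hmem : ∀ y, (r ∘ₗ φ.hom.hom) y ∈ LinearMap.range ψ.hom.hom := fun y => by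
    refine (cokerπ_apply_eq_zero_iff ψ _).1 ((hr' _).trans ?_)
    rw [(cokerπ_apply_eq_zero_iff φ _).2 ⟨y, rfl⟩, map_zero]
  obtain ⟨l, hl⟩ := Module.projective_lifting_property ψ.hom.hom.rangeRestrict
    ((r ∘ₗ φ.hom.hom).codRestrict _ hmem) ψ.hom.hom.surjective_rangeRestrict
  refine ⟨Arrow.homMk (ModuleCat.ofHom l) (ModuleCat.ofHom r) ?_, ?_⟩
  · ext y
    exact congrArg Subtype.val (DFunLike.congr_fun hl y)
  · ext x
    obtain ⟨x, rfl⟩ := cokerπ_surjective φ x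
    exact (coker_map_cokerπ _ x).trans (hr' x)

/-- The cokernel of `φ` is isomorphic to any `N` for which `φ`, `π : φ.right → N` is right exact. -/
lemma nonempty_coker_iso (φ : Arrow (ModuleCat.{u} B)) {N : ModuleCat.{u} B}
    (π : φ.right →ₗ[B] N) (hπ : Function.Surjective π) (hex : Function.Exact φ.hom.hom π) :
    Nonempty ((coker (ModuleCat.{u} B)).obj φ ≅ N) := by
  let c : (coker (ModuleCat.{u} B)).obj φ ⟶ N := cokernel.desc φ.hom (ModuleCat.ofHom π)
    (by ext y; exact hex.apply_apply_eq_zero y)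
  have hc : ∀ x, c.hom (cokerπ φ x) = π x := fun x =>
    congrArg (fun f => f.hom x) (cokernel.π_desc φ.hom (ModuleCat.ofHom π) _)
  refine ⟨(LinearEquiv.ofBijective c.hom ⟨?_, fun n => ?_⟩).toModuleIso⟩
  · refine (injective_iff_map_eq_zero c.hom).2 fun x hx => ?_
    obtain ⟨x, rfl⟩ := cokerπ_surjective φ x
    rw [hc] at hx
    exact (cokerπ_apply_eq_zero_iff φ x).2 ((hex x).1 hx)
  · obtain ⟨x, rfl⟩ := hπ n
    exact ⟨_, hc x⟩

end Coker

/-! ### Density, fullness and faithfulness of the cokernel functor on `ℳ` and `ℳ₀`. -/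

namespace IsSourceIdem

variable {L : Type u} [Ring L] {e : L} (H : IsSourceIdem e)
include H

/-- A homomorphism out of a sum of copies of `e L` is determined by its restriction to the
`e`-part. -/
lemma eq_of_smul_sub_eq_zero {ν F N : Type*} [AddCommGroup F] [Module Lᵐᵒᵖ F] [AddCommGroup N]
    [Module Lᵐᵒᵖ N] (w : F ≃ₗ[Lᵐᵒᵖ] (ν →₀ IdemModule e)) (g g' : F →ₗ[Lᵐᵒᵖ] N)
    (h : ∀ x, op e • (g x - g' x) = 0) : g = g' := by
  have h' : g ∘ₗ w.symm.toLinearMap = g' ∘ₗ w.symm.toLinearMap := by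
    refine Finsupp.lhom_ext fun i a => ?_
    have h1 : Finsupp.single i a = op a.1 • op e • Finsupp.single i (idemElem e) := by
      rw [Finsupp.smul_single, Finsupp.smul_single]
      congr 1
      rw [← mul_smul, ← op_mul, mul_val H.idem, smul_idemElem H.idem]
    rw [h1, map_smul, map_smul, map_smul, map_smul]
    congr 1
    rw [← sub_eq_zero, ← smul_sub]
    exact h _
  ext x
  simpa using DFunLike.congr_fun h' (w x)

end IsSourceIdem

namespace Extendable

variable {K A P : Type u} [Field K] [Ring A] [Algebra K A] [PartialOrder P]
  [Fintype P] [DecidableEq P] {T : MultSystem K A P} {X : Extendable T}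

/-- The identity between the two forms of `(e_0 Λ)^(ν)`. -/
def finsuppE0Equiv (X : Extendable T) (ν : Type u) :
    (ν →₀ X.e0Λ) ≃ₗ[X.Λᵐᵒᵖ] (ν →₀ IdemModule X.e0) :=
  Finsupp.mapRange.linearEquiv
    (show X.e0Λ ≃ₗ[X.Λᵐᵒᵖ] IdemModule X.e0 from LinearEquiv.refl X.Λᵐᵒᵖ (rightIdeal X.e0))

namespace IsM

variable {φ : Arrow X.ModΛ} (hφ : X.IsM φ)
include hφ

lemma exists_equiv : ∃ ν : Type u, Nonempty (φ.right ≃ₗ[X.Λᵐᵒᵖ] (ν →₀ IdemModule X.e0)) := by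
  obtain ⟨ν, ⟨i⟩⟩ := hφ.2.2.1
  exact ⟨ν, ⟨i.toLinearEquiv.trans (X.finsuppE0Equiv ν)⟩⟩

lemma projective_right : Module.Projective X.Λᵐᵒᵖ φ.right := by
  obtain ⟨ν, ⟨w⟩⟩ := exists_equiv hφ
  have := projective_finsupp_idemModule X.isSourceIdem_e0.idem ν
  exact Module.Projective.of_equiv' w.symm

lemma injTop_coker : X.InjTop ((coker X.ModΛ).obj φ) := by
  obtain ⟨ν, ⟨w⟩⟩ := exists_equiv hφ
  refine (X.injTop_iff _).2 fun x => ?_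
  obtain ⟨x, rfl⟩ := cokerπ_surjective φ x
  have h1 := Module.map_jacobson_le (cokerπ φ ∘ₗ w.symm.toLinearMap)
    (Submodule.mem_map_of_mem (X.isSourceIdem_e0.smul_finsupp_mem_jacobson (w x)))
  rw [map_smul, LinearMap.comp_apply, LinearEquiv.coe_coe, LinearEquiv.symm_apply_apply] at h1
  exact h1

/-- The difference of the right components lands in the image of `ψ`, which `e_0` kills, while
`φ.right` is generated by its `e_0`-part. -/
lemma right_eq_of_coker_map_eq {ψ : Arrow X.ModΛ} (hψ : X.KillsE0 ψ.left) {f g : φ ⟶ ψ}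
    (h : (coker X.ModΛ).map f = (coker X.ModΛ).map g) : f.right = g.right := by
  obtain ⟨ν, ⟨w⟩⟩ := exists_equiv hφ
  refine ModuleCat.hom_ext (X.isSourceIdem_e0.eq_of_smul_sub_eq_zero w _ _ fun x => ?_)
  have h1 : cokerπ ψ (f.right.hom x - g.right.hom x) = 0 := by
    rw [map_sub, ← coker_map_cokerπ, ← coker_map_cokerπ, h, sub_self]
  obtain ⟨y, hy⟩ := (cokerπ_apply_eq_zero_iff ψ _).1 h1
  rw [← hy, ← map_smul, hψ y, map_zero]

end IsM

lemma exists_isM_coker_iso [FiniteDimensional K A] (N : X.ModΛ) (hN : X.InjTop N) :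
    ∃ φ : Arrow X.ModΛ, X.IsM φ ∧ Nonempty ((coker X.ModΛ).obj φ ≅ N) := by
  have H := X.isSourceIdem_e0
  obtain ⟨ν, κ, φ, π, hπ, hex⟩ := H.exists_presentation N ((X.injTop_iff N).1 hN)
  let ψ : Arrow X.ModΛ := Arrow.mk (ModuleCat.ofHom φ)
  have hk : ∀ x : κ →₀ IdemModule (1 - X.e0), op X.e0 • x = 0 := fun x => by
    ext i : 1
    exact H.smul_idemModule_one_sub (x i)
  refine ⟨ψ, ⟨projective_finsupp_idemModule ?_ κ, hk,
    ⟨ν, ⟨((X.finsuppE0Equiv ν).symm).toModuleIso⟩⟩, ?_⟩, nonempty_coker_iso ψ π hπ hex⟩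
  · rw [mul_sub, mul_one, sub_mul, one_mul, H.idem, sub_self, sub_zero]
  -- Since `x = x (1 - e_0)`, also `φ x = (φ x) (1 - e_0)`, which is in the radical.
  · rintro _ ⟨x, rfl⟩
    have h1 := H.smul_finsupp_mem_jacobson (φ x)
    rw [← map_smul, one_sub_smul_of_smul_eq_zero (hk x)] at h1
    exact h1

/-- The object `Q → 0`. -/
abbrev toZero (Q : X.ModΛ) : Arrow X.ModΛ :=
  Arrow.mk (0 : Q ⟶ ModuleCat.of X.Λᵐᵒᵖ PUnit.{u + 1})

/-- The object `0 → e_0 Λ`. -/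
abbrev zeroTo (X : Extendable T) : Arrow X.ModΛ :=
  Arrow.mk (0 : ModuleCat.of X.Λᵐᵒᵖ PUnit.{u + 1} ⟶ X.e0Λ)

lemma isM_toZero {Q : X.ModΛ} (hQ : Module.Projective X.Λᵐᵒᵖ Q) (h0 : X.KillsE0 Q) :
    X.IsM (toZero Q) := by
  refine ⟨hQ, h0, ⟨PEmpty, ⟨(ModuleCat.isZero_of_subsingleton (ModuleCat.of _ PUnit)).iso
    (ModuleCat.isZero_of_subsingleton _)⟩⟩, ?_⟩
  rintro _ ⟨x, rfl⟩
  exact zero_mem _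

lemma isM_zeroTo : X.IsM X.zeroTo := by
  refine ⟨inferInstanceAs (Module.Projective X.Λᵐᵒᵖ PUnit.{u + 1}), fun x => rfl, ⟨PUnit,
    ⟨(Finsupp.uniqueLinearEquiv X.Λᵐᵒᵖ X.e0Λ PUnit.unit).symm.toModuleIso⟩⟩, ?_⟩
  rintro _ ⟨x, rfl⟩
  exact zero_mem _

/-- The cokernel of `0 → e_0 Λ`. -/
def cokerZeroToIso (X : Extendable T) : (coker X.ModΛ).obj X.zeroTo ≅ X.e0Λ :=
  cokernelZeroIsoTarget

/-- A retraction of cokernels lifts by fullness. The lifted composite is exactly the identity: its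
right component is determined by the cokernel, and its left component lives on `0`. -/
lemma nonempty_retract_iff {φ : Arrow X.ModΛ} (hφ : X.IsM φ) :
    Nonempty (Retract X.e0Λ ((coker X.ModΛ).obj φ)) ↔ Nonempty (Retract X.zeroTo φ) := by
  refine ⟨fun ⟨ρ⟩ => ?_, fun ⟨ρ⟩ =>
    ⟨(Retract.ofIso X.cokerZeroToIso.symm).trans (ρ.map (coker X.ModΛ))⟩⟩
  have hz : X.IsM X.zeroTo := isM_zeroTo
  have := hz.1
  have := hφ.1
  have := IsM.projective_right hz
  have := IsM.projective_right hφ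
  let σ := (Retract.ofIso X.cokerZeroToIso).trans ρ
  obtain ⟨i, hi⟩ := coker_map_surjective σ.i
  obtain ⟨r, hr⟩ := coker_map_surjective σ.r
  refine ⟨⟨i, r, ?_⟩⟩
  ext1
  · exact (ModuleCat.isZero_of_subsingleton (ModuleCat.of X.Λᵐᵒᵖ PUnit)).eq_of_src _ _
  · refine IsM.right_eq_of_coker_map_eq hz hz.2.1 ?_
    rw [Functor.map_comp, hi, hr, σ.retract]
    exact ((coker X.ModΛ).map_id _).symm

lemma isV_coker {φ : Arrow X.ModΛ} (hφ : X.IsM₀ φ) : X.IsV ((coker X.ModΛ).obj φ) :=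
  ⟨IsM.injTop_coker hφ.1, not_nonempty_iff.1 fun h =>
    not_nonempty_iff.2 hφ.2 ((nonempty_retract_iff hφ.1).1 h)⟩

lemma exists_isM₀_coker_iso [FiniteDimensional K A] (N : X.ModΛ) (hN : X.IsV N) :
    ∃ φ : Arrow X.ModΛ, X.IsM₀ φ ∧ Nonempty ((coker X.ModΛ).obj φ ≅ N) := by
  obtain ⟨φ, hφ, ⟨i⟩⟩ := exists_isM_coker_iso N hN.1
  refine ⟨φ, ⟨hφ, not_nonempty_iff.1 fun h => ?_⟩, ⟨i⟩⟩
  obtain ⟨ρ⟩ := (nonempty_retract_iff hφ).2 h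
  exact hN.2.false (ρ.trans (Retract.ofIso i))

/-- Otherwise the identity of `e_0 Λ ≠ 0` would factor through `0`. So the factorizations needed for
faithfulness stay inside `ℳ₀`. -/
lemma isM₀_toZero {Q : X.ModΛ} (hQ : Module.Projective X.Λᵐᵒᵖ Q) (h0 : X.KillsE0 Q) :
    X.IsM₀ (toZero Q) := by
  refine ⟨isM_toZero hQ h0, ⟨fun ρ => ?_⟩⟩
  have h1 : IsZero X.e0Λ := (IsZero.iff_id_eq_zero _).2 (by
    have h2 : ρ.i.right ≫ ρ.r.right = 𝟙 X.e0Λ := congrArg CommaMorphism.right ρ.retract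
    rw [← h2, (ModuleCat.isZero_of_subsingleton (ModuleCat.of X.Λᵐᵒᵖ PUnit)).eq_of_tgt
      ρ.i.right 0, zero_comp])
  have := ModuleCat.subsingleton_of_isZero h1
  exact X.isSourceIdem_e0.ne_zero (congrArg Subtype.val
    (Subsingleton.elim (α := X.e0Λ) ⟨X.e0, mem_rightIdeal_self _⟩ 0))

/-- The functor induced by `Cok` on a full subcategory of `ℳ` is an equivalence onto its essential
image, provided the subcategory contains the objects `Q → 0`. -/
lemma isEquivalence_cokBar {W : ObjectProperty (Arrow X.ModΛ)} {V : ObjectProperty X.ModΛ}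
    (h : ∀ φ : Arrow X.ModΛ, W φ → V ((coker X.ModΛ).obj φ)) (hW : ∀ φ, W φ → X.IsM φ)
    (hzero : ∀ Q : X.ModΛ, Module.Projective X.Λᵐᵒᵖ Q → X.KillsE0 Q → W (toZero Q))
    (hess : ∀ N, V N → ∃ φ : Arrow X.ModΛ, W φ ∧ Nonempty ((coker X.ModΛ).obj φ ≅ N)) :
    (CokBar W V h).IsEquivalence where
  faithful := ⟨fun {a b} f g hfg => by
    obtain ⟨f, rfl⟩ := (CategoryTheory.Quotient.functor (homRel W)).map_surjective (X := a.as) (Y := b.as) f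
    obtain ⟨g, rfl⟩ := (CategoryTheory.Quotient.functor (homRel W)).map_surjective (X := a.as) (Y := b.as) g
    refine CategoryTheory.Quotient.sound _ ?_
    have ha := hW _ a.as.property
    have hcok : (coker X.ModΛ).map f.hom = (coker X.ModΛ).map g.hom := congrArg V.ι.map hfg
    have hr := IsM.right_eq_of_coker_map_eq ha (hW _ b.as.property).2.1 hcok
    -- The right components agree, so `f - g` is its left component alone. It factors through `Q →
    -- 0`, with `Q` the left term of the source: first the identity of `Q`, then that left
    -- component.
    refine ⟨⟨toZero a.as.obj.left, hzero _ ha.1 ha.2.1⟩,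
      inferInstanceAs (Subsingleton PUnit.{u + 1}), ⟨Arrow.homMk (𝟙 _) 0 (by simp)⟩,
      ⟨Arrow.homMk (f.hom.left - g.hom.left) 0 ?_⟩, ?_⟩
    · change (f.hom.left - g.hom.left) ≫ b.as.obj.hom = 0 ≫ 0
      rw [Preadditive.sub_comp, Arrow.w, Arrow.w, hr, sub_self, zero_comp]
    · apply W.ι.map_injective
      ext1
      · exact (Category.id_comp _).symm
      · change f.hom.right - g.hom.right = 0 ≫ 0
        rw [hr, sub_self, zero_comp]⟩
  full := ⟨fun {a b} g => by
    have ha := hW _ a.as.property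
    have := ha.1
    have := IsM.projective_right ha
    obtain ⟨f, hf⟩ := coker_map_surjective (φ := a.as.obj) (ψ := b.as.obj) g.hom
    exact ⟨(CategoryTheory.Quotient.functor (homRel W)).map ⟨f⟩, V.ι.map_injective hf⟩⟩
  essSurj := ⟨fun N => by
    obtain ⟨φ, hφ, ⟨i⟩⟩ := hess N.obj N.property
    exact ⟨(CategoryTheory.Quotient.functor (homRel W)).obj ⟨φ, hφ⟩, ⟨V.fullyFaithfulι.preimageIso i⟩⟩⟩

end Extendable

end EquippedPoset

end

theorem mainTheorem7 {K A P : Type u} [Field K] [Ring A] [Algebra K A] [FiniteDimensional K A]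
    [PartialOrder P] [Fintype P] [DecidableEq P] (T : EquippedPoset.MultSystem K A P)
    (X : EquippedPoset.Extendable T) :
    (∃ h : ∀ φ : Arrow X.ModΛ, X.IsM φ → X.InjTop ((Limits.coker X.ModΛ).obj φ),
      (EquippedPoset.Extendable.CokBar X.IsM X.InjTop h).IsEquivalence) ∧
    (∃ h : ∀ φ : Arrow X.ModΛ, X.IsM₀ φ → X.IsV ((Limits.coker X.ModΛ).obj φ),
      (EquippedPoset.Extendable.CokBar X.IsM₀ X.IsV h).IsEquivalence) := by
  exact ⟨⟨fun _ hφ => EquippedPoset.Extendable.IsM.injTop_coker hφ,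
      EquippedPoset.Extendable.isEquivalence_cokBar _ (fun _ hφ => hφ)
        (fun _ => EquippedPoset.Extendable.isM_toZero)
        EquippedPoset.Extendable.exists_isM_coker_iso⟩,
    ⟨fun _ hφ => EquippedPoset.Extendable.isV_coker hφ,
      EquippedPoset.Extendable.isEquivalence_cokBar _ (fun _ hφ => hφ.1)
        (fun _ => EquippedPoset.Extendable.isM₀_toZero)
        EquippedPoset.Extendable.exists_isM₀_coker_iso⟩⟩
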